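/- Let $K,L,A,B$ be non-empty finite sets, $M:K\times L\times A\times B\to\mathbb{R}$ a one-stage payoff with $M^{kl}_{a,b}=M(k,l,a,b)$, and $n\ge 1$. Write $\Delta(S)$ for the probability distributions on a finite set $S$, and $H^A_s=A^{s-1}$, $H^B_s=B^{s-1}$ for the action histories before stage $s$ (for $s=1$ only the empty history). A behavior strategy of player 1 is $\sigma=(\sigma_s)_{s=1}^n$ with $\sigma_s:K\times H^A_s\times H^B_s\to\Delta(A)$; one of player 2 is $\tau=(\tau_s)_{s=1}^n$ with $\tau_s:L\times H^A_s\times H^B_s\to\Delta(B)$. For $p\in\Delta(K)$, $q\in\Delta(L)$ let $\mathbb{E}_{p,q,\sigma,\tau}$ be the expectation when $k\sim p$ and $l\sim q$ are independent and, at each stage, both players act independently according to $\sigma,\tau$, observing their own type and all past actions. *Dual games.* In the $n$-stage type 2 dual game $\tilde\Gamma^2_n(p,\nu)$, $p\in\Delta(K)$, $\nu\in\mathbb{R}^{L}$, player 1 chooses $\sigma$, player 2 chooses $q\in\Delta(L)$ and $\tau$, and the payoff is $\mathbb{E}_{p,q,\sigma,\tau}\big(\nu^l+\sum_{s=1}^n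 M(k,l,a_s,b_s)\big)$. In the $n$-stage type 1 dual game $\tilde\Gamma^1_n(\mu,q)$, $\mu\in\mathbb{R}^{K}$, $q\in\Delta(L)$, player 1 chooses $p\in\Delta(K)$ and $\sigma$, player 2 chooses $\tau$, and the payoff is $\mathbb{E}_{p,q,\sigma,\tau}\big(\mu^k+\sum_{s=1}^n M(k,l,a_s,b_s)\big)$. Player 1 maximizes and player 2 minimizes. The value, denoted $\tilde V^2_n(p,\nu)$ resp. $\tilde V^1_n(\mu,q)$, is the common value of $\max\min$ and $\min\max$; a security strategy of player 1 (player 2) is a strategy attaining the outer maximum (minimum). **Theorem.** (1) For all $p_t\in\Delta(K)$ and $\nu_t\in\mathbb{R}^L$ (in particular when these are the belief on player 1's type and the regret on player 2's type at stage $t$ of a $T$-stage type 2 dual game, with $n=T+1-t$), the game $\tilde\Gamma^2_n(p_t,\nu_t)$ has a value, and $\tilde V^2_n(p_t,\nu_t)$ is the (attained) maximum of $\tilde u$ over all real $x,u,u_{:,0},\tilde u$ such that - $u_{l,0}+\nu_t^l\ge\tilde u$ for all $l\in L$; - $\sum_{k}\sum_{a} M^{kl}_{a,b}\,x^{a}_{k,h_1^A,h_1^B}+\sum_{a}u^{a,b}_{l,h^A_1,h^B_1}\ge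 u_{l,0}$ for all $l\in L$, $b\in B$; - $\sum_k\sum_{a'}M^{kl}_{a',b'}\,x^{a'}_{k,(h^A_s,a),(h^B_s,b)}+\sum_{a'}u^{a',b'}_{l,(h^A_s,a),(h^B_s,b)}\ge u^{a,b}_{l,h^A_s,h^B_s}$ for all $s=1,\dots,n-1$, $l\in L$, $h_s^A\in H_s^A$, $h_s^B\in H_s^B$, $a\in A$, $b,b'\in B$; - $u_{l,h_n^A,h_n^B}=0$ for all $l\in L$ and all histories $h_n^A,h_n^B$; - $x\ge 0$, $\sum_a x^a_{k,h_1^A,h_1^B}=p_t^k$ for all $k \in K$, and $\sum_{a'}x^{a'}_{k,(h^A_s,a),(h^B_s,b)}=x^a_{k,h_s^A,h_s^B}$ for all $s=1,\dots,n-1$, $k\in K$, $h_s^A\in H_s^A$, $h_s^B\in H_s^B$, $a\in A$, $b\in B$. Player 1's stage-$t$ security strategies, i.e. the first-stage components of his security strategies in $\tilde\Gamma^2_n(p_t,\nu_t)$, are given by $$\tilde\sigma^*_t(k,p_t,\nu_t)=\frac{x^*_{k,h_1^A,h_1^B}}{p_t^k}\qquad\text{for all }k\text{ with }p_t^k>0,$$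 that is: for every optimal solution $x^*$ of the linear program there is a security strategy of player 1 in $\tilde\Gamma_n^2(p_t,\nu_t)$ whose first-stage component satisfies this formula, and the first-stage component of every security strategy of player 1 in $\tilde\Gamma_n^2(p_t,\nu_t)$ satisfies it for some optimal solution $x^*$. (2) Symmetrically, for all $\mu_t\in\mathbb{R}^K$ and $q_t\in\Delta(L)$ (in particular for the regret and the belief at stage $t$ of a $T$-stage type 1 dual game, with $n=T+1-t$), the game $\tilde\Gamma^1_n(\mu_t,q_t)$ has a value, and $\tilde V^1_n(\mu_t,q_t)$ is the (attained) minimum of $\tilde w$ over all real $y,w,w_{:,0},\tilde w$ such that - $w_{k,0}+\mu_t^k\le\tilde w$ for all $k\in K$; - $\sum_{l}\sum_{b} M^{kl}_{a,b}\,y^{b}_{l,h_1^A,h_1^B}+\sum_{b}w^{a,b}_{k,h^A_1,h^B_1}\le w_{k,0}$ for all $k\in K$, $a\in A$; - $\sum_l\sum_{b'}M^{kl}_{a',b'}\,y^{b'}_{l,(h^A_s,a),(h^B_s,b)}+\sum_{b'}w^{a',b'}_{k,(h^A_s,a),(h^B_s,b)}\le w^{a,b}_{k,h^A_s,h^B_s}$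 for all $s=1,\dots,n-1$, $k\in K$, $h_s^A\in H_s^A$, $h_s^B\in H_s^B$, $a,a'\in A$, $b\in B$; - $w_{k,h_n^A,h_n^B}=0$ for all $k\in K$ and all histories $h_n^A,h_n^B$; - $y\ge 0$, $\sum_b y^b_{l,h_1^A,h_1^B}=q_t^l$ for all $l\in L$, and $\sum_{b'}y^{b'}_{l,(h^A_s,a),(h^B_s,b)}=y^b_{l,h_s^A,h_s^B}$ for all $s=1,\dots,n-1$, $l\in L$, $h_s^A\in H_s^A$, $h_s^B\in H_s^B$, $a\in A$, $b\in B$. Player 2's stage-$t$ security strategies, i.e. the first-stage components of his security strategies in $\tilde\Gamma^1_n(\mu_t,q_t)$, are, in the same two-sided sense, given by $\tilde\tau^*_t(l,\mu_t,q_t)=y^*_{l,h_1^A,h_1^B}/q_t^l$ for all $l$ with $q_t^l>0$, where $y^*$ ranges over the optimal solutions of this linear program. -/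

import Mathlib

namespace BayesianGame

/-! Zero-sum games: player 1 maximizes `γ s₁ s₂`, player 2 minimizes it. -/

section ZeroSum

variable {S₁ S₂ : Type*} (γ : S₁ → S₂ → ℝ)

/-- `v = max_{s₁} min_{s₂} γ s₁ s₂`, with all extrema attained. -/
def IsSecurityLevel₁ (v : ℝ) : Prop :=
  IsGreatest {g : ℝ | ∃ s₁, IsLeast (Set.range fun s₂ => γ s₁ s₂) g} v

/-- `v = min_{s₂} max_{s₁} γ s₁ s₂`, with all extrema attained. -/
def IsSecurityLevel₂ (v : ℝ) : Prop :=
  IsLeast {g : ℝ | ∃ s₂, IsGreatest (Set.range fun s₁ => γ s₁ s₂) g} v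

/-- The game has value `v`: both security levels exist and are equal to `v`. -/
def HasValue (v : ℝ) : Prop := IsSecurityLevel₁ γ v ∧ IsSecurityLevel₂ γ v

/-- A strategy of player 1 whose worst-case payoff is the security level of player 1. -/
def IsSecurityStrategy₁ (s₁ : S₁) : Prop :=
  ∃ v, IsSecurityLevel₁ γ v ∧ IsLeast (Set.range fun s₂ => γ s₁ s₂) v

/-- A strategy of player 2 whose worst-case payoff is the security level of player 2. -/
def IsSecurityStrategy₂ (s₂ : S₂) : Prop :=
  ∃ v, IsSecurityLevel₂ γ v ∧ IsGreatest (Set.range fun s₁ => γ s₁ s₂) v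

end ZeroSum

/-! Stages are numbered from `0` to `n - 1`, so that the histories before stage `t` are pairs of
functions `Fin t → A`, `Fin t → B`. -/

/-- Behavior strategies of player 1 in the `n`-stage game: at each stage, a map from his type and
the history of both players to the probability distributions on his actions. -/
abbrev Strategy₁ (n : ℕ) (K A B : Type*) [Fintype A] : Type _ :=
  (t : Fin n) → K → (Fin t → A) → (Fin t → B) → stdSimplex ℝ A

/-- Behavior strategies of player 2 in the `n`-stage game. -/
abbrev Strategy₂ (n : ℕ) (L A B : Type*) [Fintype B] : Type _ :=
  (t : Fin n) → L → (Fin t → A) → (Fin t → B) → stdSimplex ℝ B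

/-- The actions taken before stage `t` in a complete sequence of actions. -/
def past {n : ℕ} {C : Type*} (c : Fin n → C) (t : Fin n) : Fin t → C :=
  fun i => c (Fin.castLE t.isLt.le i)

variable {n : ℕ} {K L A B : Type*} [Fintype K] [Fintype L] [Fintype A] [Fintype B]

/-- The probability of the play `(k, l, α, β)` when the types are drawn independently from `p` and
`q` and the players use `σ` and `τ`. -/
def playProb (p : K → ℝ) (q : L → ℝ) (σ : Strategy₁ n K A B) (τ : Strategy₂ n L A B)
    (k : K) (l : L) (α : Fin n → A) (β : Fin n → B) : ℝ :=
  p k * q l * ∏ t : Fin n,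
    ((σ t k (past α t) (past β t)).1 (α t) * (τ t l (past α t) (past β t)).1 (β t))

/-- The expectation of a function of the play. -/
def expect (p : K → ℝ) (q : L → ℝ) (σ : Strategy₁ n K A B) (τ : Strategy₂ n L A B)
    (f : K → L → (Fin n → A) → (Fin n → B) → ℝ) : ℝ :=
  ∑ k, ∑ l, ∑ α : Fin n → A, ∑ β : Fin n → B, playProb p q σ τ k l α β * f k l α β

/-- Payoff in the `n`-stage type 1 dual game with initial regret `μ` and law `q` of the type of
player 2; player 1 chooses the law of his own type and a behavior strategy. -/
def dualPayoff₁ (M : K → L → A → B → ℝ) (μ : K → ℝ) (q : L → ℝ)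
    (s₁ : stdSimplex ℝ K × Strategy₁ n K A B) (τ : Strategy₂ n L A B) : ℝ :=
  expect s₁.1.1 q s₁.2 τ fun k l α β => μ k + ∑ t, M k l (α t) (β t)

/-- Payoff in the `n`-stage type 2 dual game with law `p` of the type of player 1 and initial
regret `ν`; player 2 chooses the law of his own type and a behavior strategy. -/
def dualPayoff₂ (M : K → L → A → B → ℝ) (p : K → ℝ) (ν : L → ℝ)
    (σ : Strategy₁ n K A B) (s₂ : stdSimplex ℝ L × Strategy₂ n L A B) : ℝ :=
  expect p s₂.1.1 σ s₂.2 fun k l α β => ν l + ∑ t, M k l (α t) (β t)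

/-- The polytope `X` of realization plans of player 1 with root values `p`. -/
structure IsPlan₁ (p : K → ℝ)
    (x : (t : Fin n) → K → (Fin t → A) → (Fin t → B) → A → ℝ) : Prop where
  nonneg : ∀ t k hA hB a, 0 ≤ x t k hA hB a
  root : ∀ (h : 0 < n) k, ∑ a, x ⟨0, h⟩ k Fin.elim0 Fin.elim0 a = p k
  step : ∀ (t : ℕ) (h : t + 1 < n) k (hA : Fin t → A) (hB : Fin t → B) a b,
    ∑ a', x ⟨t + 1, h⟩ k (Fin.snoc hA a) (Fin.snoc hB b) a' = x ⟨t, by omega⟩ k hA hB a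

/-- The polytope `Y` of realization plans of player 2 with root values `q`. -/
structure IsPlan₂ (q : L → ℝ)
    (y : (t : Fin n) → L → (Fin t → A) → (Fin t → B) → B → ℝ) : Prop where
  nonneg : ∀ t l hA hB b, 0 ≤ y t l hA hB b
  root : ∀ (h : 0 < n) l, ∑ b, y ⟨0, h⟩ l Fin.elim0 Fin.elim0 b = q l
  step : ∀ (t : ℕ) (h : t + 1 < n) l (hA : Fin t → A) (hB : Fin t → B) a b,
    ∑ b', y ⟨t + 1, h⟩ l (Fin.snoc hA a) (Fin.snoc hB b) b' = y ⟨t, by omega⟩ l hA hB b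

/-- The constraints of the linear program of player 1 in the type 2 dual game; the objective
`uTop` is maximized. -/
structure DualFeasible₁ (M : K → L → A → B → ℝ) (p : K → ℝ) (ν : L → ℝ)
    (x : (t : Fin n) → K → (Fin t → A) → (Fin t → B) → A → ℝ)
    (u : (t : Fin n) → L → (Fin t → A) → (Fin t → B) → A → B → ℝ)
    (u₀ : L → ℝ) (uTop : ℝ) : Prop where
  plan : IsPlan₁ p x
  terminal : ∀ t : Fin n, (t : ℕ) + 1 = n → ∀ l hA hB a b, u t l hA hB a b = 0
  top : ∀ l, uTop ≤ u₀ l + ν l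
  root : ∀ (h : 0 < n) l b,
    u₀ l ≤ ∑ k, ∑ a, M k l a b * x ⟨0, h⟩ k Fin.elim0 Fin.elim0 a
      + ∑ a, u ⟨0, h⟩ l Fin.elim0 Fin.elim0 a b
  step : ∀ (t : ℕ) (h : t + 1 < n) l (hA : Fin t → A) (hB : Fin t → B) a b b',
    u ⟨t, by omega⟩ l hA hB a b ≤
      ∑ k, ∑ a', M k l a' b' * x ⟨t + 1, h⟩ k (Fin.snoc hA a) (Fin.snoc hB b) a'
        + ∑ a', u ⟨t + 1, h⟩ l (Fin.snoc hA a) (Fin.snoc hB b) a' b'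

/-- The constraints of the linear program of player 2 in the type 1 dual game; the objective
`wTop` is minimized. -/
structure DualFeasible₂ (M : K → L → A → B → ℝ) (μ : K → ℝ) (q : L → ℝ)
    (y : (t : Fin n) → L → (Fin t → A) → (Fin t → B) → B → ℝ)
    (w : (t : Fin n) → K → (Fin t → A) → (Fin t → B) → A → B → ℝ)
    (w₀ : K → ℝ) (wTop : ℝ) : Prop where
  plan : IsPlan₂ q y
  terminal : ∀ t : Fin n, (t : ℕ) + 1 = n → ∀ k hA hB a b, w t k hA hB a b = 0
  top : ∀ k, w₀ k + μ k ≤ wTop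
  root : ∀ (h : 0 < n) k a,
    ∑ l, ∑ b, M k l a b * y ⟨0, h⟩ l Fin.elim0 Fin.elim0 b
      + ∑ b, w ⟨0, h⟩ k Fin.elim0 Fin.elim0 a b ≤ w₀ k
  step : ∀ (t : ℕ) (h : t + 1 < n) k (hA : Fin t → A) (hB : Fin t → B) a b a',
    ∑ l, ∑ b', M k l a' b' * y ⟨t + 1, h⟩ l (Fin.snoc hA a) (Fin.snoc hB b) b'
        + ∑ b', w ⟨t + 1, h⟩ k (Fin.snoc hA a) (Fin.snoc hB b) a' b'
      ≤ w ⟨t, by omega⟩ k hA hB a b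

end BayesianGame

/-! The payoff is multilinear in behavior strategies, but it becomes affine in each player's
realization plan, the product of the prior and the player's own action probabilities
(`dualPayoff₂_eq_planPayoff`). Plans form compact convex sets, and every plan comes from a behavior
strategy (`range_planOf`, `range_planOf₂`), so Sion's theorem gives a saddle point with value `v`
(`exists_saddle_dualPayoff₂`).

Fix a plan `x` of player 1. Player 2 then faces a finite decision tree for each type `l`, with
lowest payoff `u₀ l` by backward induction, and chooses the type minimizing `ν l + u₀ l`. The
constraints of the program say that `u` is a lower bound for the continuation values of this tree
and `uTop` for the resulting minimum. Hence `x` extends to a feasible point with objective `w`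
exactly when `x` guarantees `w`: one direction telescopes the inequalities
(`DualFeasible₁.le_planPayoff`), the other takes `u` to be the continuation values
(`exists_dualFeasible₁`). So the optimum of the program is `v`, and the optimal `x` are the plans of
the security strategies. The type 1 game follows by exchanging the players and changing signs. -/

namespace BayesianGame

/-! ### Histories extended by one action -/

section Histories

/-- Summing over histories of length `t + 1` by their last entry. -/
theorem sum_hist_succ {C : Type*} [Fintype C] (t : ℕ) (f : (Fin (t + 1) → C) → ℝ) :
    ∑ h, f h = ∑ h : Fin t → C, ∑ c, f (Fin.snoc h c) := by
  rw [← (Fin.snocEquiv fun _ => C).sum_comp, Fintype.sum_prod_type, Finset.sum_comm]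
  rfl

theorem sum_hist_zero {A B : Type*} [Fintype A] [Fintype B]
    (f : (Fin 0 → A) → (Fin 0 → B) → ℝ) :
    ∑ hA, ∑ hB, f hA hB = f Fin.elim0 Fin.elim0 := by
  rw [Fintype.sum_unique, Fintype.sum_unique]
  congr 1

theorem past_snoc_castSucc {C : Type*} {t : ℕ} (h : Fin t → C) (c : C) (i : Fin t) :
    past (Fin.snoc h c : Fin (t + 1) → C) i.castSucc = past h i := by
  funext j
  exact Fin.snoc_castSucc (α := fun _ => C) c h (Fin.castLE i.isLt.le j)

theorem past_snoc_last {C : Type*} {t : ℕ} (h : Fin t → C) (c : C) :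
    past (Fin.snoc h c : Fin (t + 1) → C) (Fin.last t) = h := by
  funext j
  exact Fin.snoc_castSucc (α := fun _ => C) c h j

end Histories

/-! ### Behavior strategies and realization plans -/

section Plans

variable {n : ℕ} {K L A B : Type*}

section Player₁

variable [Fintype A]

/-- The contribution of player 1's choices to the probability of a history. -/
def reach (σ : Strategy₁ n K A B) (k : K) (m : ℕ) (hm : m ≤ n) (hA : Fin m → A)
    (hB : Fin m → B) : ℝ :=
  ∏ i : Fin m, (σ ⟨i, i.isLt.trans_le hm⟩ k (past hA i) (past hB i)).1 (hA i)

theorem reach_snoc (σ : Strategy₁ n K A B) (k : K) (m : ℕ) (hm : m < n) (hA : Fin m → A)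
    (hB : Fin m → B) (a : A) (b : B) :
    reach σ k (m + 1) hm (Fin.snoc hA a) (Fin.snoc hB b) =
      reach σ k m hm.le hA hB * (σ ⟨m, hm⟩ k hA hB).1 a := by
  unfold reach
  rw [Fin.prod_univ_castSucc]
  congr 1
  · refine Finset.prod_congr rfl fun i _ => ?_
    rw [past_snoc_castSucc, past_snoc_castSucc, Fin.snoc_castSucc]
    rfl
  · rw [past_snoc_last, past_snoc_last, Fin.snoc_last]
    rfl

theorem reach_nonneg (σ : Strategy₁ n K A B) (k : K) (m : ℕ) (hm : m ≤ n) (hA : Fin m → A)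
    (hB : Fin m → B) : 0 ≤ reach σ k m hm hA hB :=
  Finset.prod_nonneg fun _ _ => (σ _ k _ _).2.1 _

/-- The realization plan of a behavior strategy of player 1. -/
def planOf (p : K → ℝ) (σ : Strategy₁ n K A B) (t : Fin n) (k : K) (hA : Fin t → A)
    (hB : Fin t → B) (a : A) : ℝ :=
  p k * reach σ k t t.isLt.le hA hB * (σ t k hA hB).1 a

theorem planOf_zero (p : K → ℝ) (σ : Strategy₁ n K A B) (h : 0 < n) (k : K) (hA : Fin 0 → A)
    (hB : Fin 0 → B) (a : A) :
    planOf p σ ⟨0, h⟩ k hA hB a = p k * (σ ⟨0, h⟩ k hA hB).1 a := by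
  simp [planOf, reach]

theorem planOf_snoc (p : K → ℝ) (σ : Strategy₁ n K A B) (t : ℕ) (h : t + 1 < n) (k : K)
    (hA : Fin t → A) (hB : Fin t → B) (a : A) (b : B) (a' : A) :
    planOf p σ ⟨t + 1, h⟩ k (Fin.snoc hA a) (Fin.snoc hB b) a' =
      planOf p σ ⟨t, by omega⟩ k hA hB a *
        (σ ⟨t + 1, h⟩ k (Fin.snoc hA a) (Fin.snoc hB b)).1 a' := by
  unfold planOf
  rw [reach_snoc σ k t (by omega), ← mul_assoc (p k)]

theorem isPlan₁_planOf {p : K → ℝ} (hp : ∀ k, 0 ≤ p k) (σ : Strategy₁ n K A B) :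
    IsPlan₁ p (planOf p σ) where
  nonneg _ k _ _ a := mul_nonneg (mul_nonneg (hp k) (reach_nonneg ..)) ((σ _ k _ _).2.1 a)
  root h k := by
    simp_rw [planOf_zero, ← Finset.mul_sum]
    rw [(σ _ k _ _).2.2, mul_one]
  step t h k hA hB a b := by
    simp_rw [planOf_snoc, ← Finset.mul_sum]
    rw [(σ _ k _ _).2.2, mul_one]

/-- Normalization in product form, so that it also covers total mass zero: then `f` vanishes and any
distribution will do. This gives the conditional law at histories that a plan does not reach. -/
theorem exists_stdSimplex_mul_sum [Nonempty A] (f : A → ℝ) (hf : ∀ a, 0 ≤ f a) :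
    ∃ s : stdSimplex ℝ A, ∀ a, (∑ a', f a') * s.1 a = f a := by
  classical
  rcases (Finset.sum_nonneg fun a _ => hf a : 0 ≤ ∑ a', f a').eq_or_lt with h | h
  · obtain ⟨a₀⟩ := ‹Nonempty A›
    refine ⟨⟨Pi.single a₀ 1, single_mem_stdSimplex ℝ a₀⟩, fun a => ?_⟩
    rw [← h, zero_mul, (Finset.sum_eq_zero_iff_of_nonneg fun a _ => hf a).1 h.symm a
      (Finset.mem_univ a)]
  · refine ⟨⟨fun a => f a / ∑ a', f a', fun a => div_nonneg (hf a) h.le, ?_⟩, fun a => ?_⟩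
    · rw [← Finset.sum_div, div_self h.ne']
    · exact mul_div_cancel₀ _ h.ne'

/-- Every realization plan of player 1 is induced by a behavior strategy. -/
theorem IsPlan₁.exists_planOf_eq [Nonempty A] {p : K → ℝ}
    {x : (t : Fin n) → K → (Fin t → A) → (Fin t → B) → A → ℝ} (hx : IsPlan₁ p x) :
    ∃ σ : Strategy₁ n K A B, planOf p σ = x := by
  choose σ hσ using fun (t : Fin n) k hA hB =>
    exists_stdSimplex_mul_sum (x t k hA hB) (hx.nonneg t k hA hB)
  refine ⟨σ, ?_⟩
  suffices h : ∀ (t : ℕ) (ht : t < n) k hA hB a,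
      planOf p σ ⟨t, ht⟩ k hA hB a = x ⟨t, ht⟩ k hA hB a by
    funext t k hA hB a
    exact h t t.isLt k hA hB a
  intro t
  induction t with
  | zero =>
    intro ht k hA hB a
    have e₁ : hA = Fin.elim0 := Subsingleton.elim _ _
    have e₂ : hB = Fin.elim0 := Subsingleton.elim _ _
    subst e₁ e₂
    rw [planOf_zero, ← hx.root ht k]
    exact hσ ⟨0, ht⟩ k _ _ a
  | succ t ih =>
    intro ht k hA hB a
    rw [← Fin.snoc_init_self (α := fun _ => A) hA, ← Fin.snoc_init_self (α := fun _ => B) hB,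
      planOf_snoc, ih, ← hx.step t ht k]
    exact hσ ⟨t + 1, ht⟩ k _ _ a

/-- Plan sets are compact as continuous images of products of simplices. Continuity is joint in the
prior because in the type 2 dual game player 2 chooses his prior too. -/
theorem continuous_planOf :
    Continuous fun s : (K → ℝ) × Strategy₁ n K A B => planOf s.1 s.2 := by
  refine continuous_pi fun t => continuous_pi fun k => continuous_pi fun hA =>
    continuous_pi fun hB => continuous_pi fun a => ?_
  have h : ∀ (t : Fin n) (hA : Fin t → A) (hB : Fin t → B) (a : A),
      Continuous fun s : (K → ℝ) × Strategy₁ n K A B => (s.2 t k hA hB).1 a := fun t hA hB a =>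
    (continuous_apply a).comp (continuous_subtype_val.comp (by fun_prop))
  exact (((continuous_apply k).comp continuous_fst).mul
    (continuous_finsetProd _ fun i _ => h _ _ _ _)).mul (h t hA hB a)

end Player₁

section Player₂

variable [Fintype B]

/-- A behavior strategy of player 2, seen as one of player 1 after exchanging the players. -/
def Strategy₂.swap (τ : Strategy₂ n L A B) : Strategy₁ n L B A :=
  fun t l hB hA => τ t l hA hB

/-- The realization plan of a behavior strategy of player 2. -/
def planOf₂ (q : L → ℝ) (τ : Strategy₂ n L A B) (t : Fin n) (l : L) (hA : Fin t → A)
    (hB : Fin t → B) (b : B) : ℝ :=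
  planOf q (Strategy₂.swap τ) t l hB hA b

theorem isPlan₂_planOf₂ {q : L → ℝ} (hq : ∀ l, 0 ≤ q l) (τ : Strategy₂ n L A B) :
    IsPlan₂ q (planOf₂ q τ) where
  nonneg t l hA hB b := (isPlan₁_planOf hq (Strategy₂.swap τ)).nonneg t l hB hA b
  root h l := (isPlan₁_planOf hq (Strategy₂.swap τ)).root h l
  step t h l hA hB a b := (isPlan₁_planOf hq (Strategy₂.swap τ)).step t h l hB hA b a

theorem IsPlan₂.exists_planOf₂_eq [Nonempty B] {q : L → ℝ}
    {y : (t : Fin n) → L → (Fin t → A) → (Fin t → B) → B → ℝ} (hy : IsPlan₂ q y) :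
    ∃ τ : Strategy₂ n L A B, planOf₂ q τ = y := by
  have h : IsPlan₁ q fun t l hB hA b => y t l hA hB b :=
    ⟨fun t l hB hA b => hy.nonneg t l hA hB b, fun h l => hy.root h l,
      fun t h l hB hA b a => hy.step t h l hA hB a b⟩
  obtain ⟨σ, hσ⟩ := h.exists_planOf_eq
  refine ⟨fun t l hA hB => σ t l hB hA, ?_⟩
  funext t l hA hB b
  exact congrFun (congrFun (congrFun (congrFun (congrFun hσ t) l) hB) hA) b

theorem continuous_planOf₂ :
    Continuous fun s : (L → ℝ) × Strategy₂ n L A B => planOf₂ s.1 s.2 := by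
  have h : Continuous fun s : (L → ℝ) × Strategy₂ n L A B =>
      planOf s.1 (Strategy₂.swap s.2) := by
    refine continuous_planOf.comp (continuous_fst.prodMk ?_)
    exact continuous_pi fun t => by fun_prop
  unfold planOf₂
  fun_prop

end Player₂

variable [Fintype A] [Fintype B]

/-- Total probability of all plays given the types; it disposes of the regret term, which does not
depend on the actions. -/
theorem sum_reach_mul_reach (σ : Strategy₁ n K A B) (τ : Strategy₂ n L A B) (k : K) (l : L)
    (m : ℕ) (hm : m ≤ n) :
    ∑ α, ∑ β, reach σ k m hm α β * reach (Strategy₂.swap τ) l m hm β α = 1 := by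
  induction m with
  | zero => simp [reach]
  | succ m ih =>
    rw [← ih (by omega), sum_hist_succ]
    refine Finset.sum_congr rfl fun α _ => ?_
    simp_rw [sum_hist_succ]
    rw [Finset.sum_comm]
    refine Finset.sum_congr rfl fun β _ => ?_
    simp_rw [reach_snoc σ k m hm, reach_snoc (Strategy₂.swap τ) l m hm, mul_mul_mul_comm,
      ← Finset.mul_sum]
    rw [(Strategy₂.swap τ _ l _ _).2.2]
    rw [mul_assoc, ← Finset.sum_mul, (σ _ k _ _).2.2, mul_one, mul_one]

/-- The expectation of a sum of stage payoffs is the sum over the histories of the expected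
stage payoffs, weighted by the probability of the history. -/
theorem sum_reach_mul_sum (σ : Strategy₁ n K A B) (τ : Strategy₂ n L A B) (k : K) (l : L)
    (g : A → B → ℝ) (m : ℕ) (hm : m ≤ n) :
    ∑ α, ∑ β, reach σ k m hm α β * reach (Strategy₂.swap τ) l m hm β α * ∑ t, g (α t) (β t) =
      ∑ t : Fin m, ∑ hA : Fin t → A, ∑ hB : Fin t → B, ∑ a, ∑ b,
        reach σ k t (t.isLt.le.trans hm) hA hB *
          reach (Strategy₂.swap τ) l t (t.isLt.le.trans hm) hB hA *
          ((σ ⟨t, t.isLt.trans_le hm⟩ k hA hB).1 a *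
            (τ ⟨t, t.isLt.trans_le hm⟩ l hA hB).1 b * g a b) := by
  induction m with
  | zero => simp
  | succ m ih =>
    rw [Fin.sum_univ_castSucc]
    refine Eq.trans ?_ (congrArg (· + _) (ih (by omega)))
    rw [sum_hist_succ]
    refine Eq.trans ?_ Finset.sum_add_distrib
    refine Finset.sum_congr rfl fun α _ => ?_
    simp_rw [sum_hist_succ]
    rw [Finset.sum_comm]
    refine Eq.trans ?_ Finset.sum_add_distrib
    refine Finset.sum_congr rfl fun β _ => ?_
    -- Splits off the last stage. In the first summand the last actions sum out to probability one;
    -- the second is the stage `m` term.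
    have e : ∀ a b, reach σ k (m + 1) hm (Fin.snoc α a) (Fin.snoc β b) *
        reach (Strategy₂.swap τ) l (m + 1) hm (Fin.snoc β b) (Fin.snoc α a) *
        ∑ t, g ((Fin.snoc α a : Fin (m + 1) → A) t) ((Fin.snoc β b : Fin (m + 1) → B) t) =
        reach σ k m (by omega) α β * reach (Strategy₂.swap τ) l m (by omega) β α *
          (∑ t, g (α t) (β t)) *
          ((σ ⟨m, hm⟩ k α β).1 a * (τ ⟨m, hm⟩ l α β).1 b) +
        reach σ k m (by omega) α β * reach (Strategy₂.swap τ) l m (by omega) β α *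
          ((σ ⟨m, hm⟩ k α β).1 a * (τ ⟨m, hm⟩ l α β).1 b * g a b) := by
      intro a b
      rw [reach_snoc σ k m hm, reach_snoc (Strategy₂.swap τ) l m hm, Fin.sum_univ_castSucc]
      simp only [Fin.snoc_castSucc, Fin.snoc_last, Strategy₂.swap]
      ring
    simp_rw [e, Finset.sum_add_distrib]
    congr 1
    simp_rw [← Finset.mul_sum]
    rw [(τ _ l _ _).2.2]
    simp_rw [mul_one]
    rw [(σ _ k _ _).2.2, mul_one]

end Plans

/-! ### The payoff as a function of plans -/

section Payoff

variable {n : ℕ} {K L A B : Type*} [Fintype K] [Fintype L] [Fintype A] [Fintype B]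

/-- The payoff of player 2's type `l` at a stage, if he plays `b`, integrated over the types and
actions of player 1. -/
def stagePayoff (M : K → L → A → B → ℝ)
    (x : (t : Fin n) → K → (Fin t → A) → (Fin t → B) → A → ℝ)
    (l : L) (t : Fin n) (hA : Fin t → A) (hB : Fin t → B) (b : B) : ℝ :=
  ∑ k, ∑ a, M k l a b * x t k hA hB a

/-- The payoff of the type 2 dual game in terms of realization plans. -/
def planPayoff (M : K → L → A → B → ℝ) (ν : L → ℝ)
    (x : (t : Fin n) → K → (Fin t → A) → (Fin t → B) → A → ℝ)
    (y : (L → ℝ) × ((t : Fin n) → L → (Fin t → A) → (Fin t → B) → B → ℝ)) : ℝ :=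
  ∑ l, (ν l * y.1 l + ∑ t, ∑ hA, ∑ hB, ∑ b, stagePayoff M x l t hA hB b * y.2 t l hA hB b)

/-- The probability of a history factors into one contribution per player, and each factor together
with the prior is that player's plan. That `p` has mass one is needed for the regret term only. -/
theorem dualPayoff₂_eq_planPayoff (M : K → L → A → B → ℝ) {p : K → ℝ}
    (hp : p ∈ stdSimplex ℝ K) (ν : L → ℝ) (σ : Strategy₁ n K A B)
    (s : stdSimplex ℝ L × Strategy₂ n L A B) :
    dualPayoff₂ M p ν σ s = planPayoff M ν (planOf p σ) (s.1.1, planOf₂ s.1.1 s.2) := by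
  obtain ⟨q, τ⟩ := s
  have key : ∀ k l, ∑ α, ∑ β, playProb p q.1 σ τ k l α β * (ν l + ∑ t, M k l (α t) (β t)) =
      p k * (ν l * q.1 l) + ∑ t : Fin n, ∑ hA : Fin t → A, ∑ hB : Fin t → B, ∑ a, ∑ b,
        M k l a b * planOf p σ t k hA hB a * planOf₂ q.1 τ t l hA hB b := by
    intro k l
    have e : ∀ α β, playProb p q.1 σ τ k l α β * (ν l + ∑ t, M k l (α t) (β t)) =
        p k * (ν l * q.1 l) *
          (reach σ k n le_rfl α β * reach (Strategy₂.swap τ) l n le_rfl β α) +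
        p k * q.1 l * (reach σ k n le_rfl α β * reach (Strategy₂.swap τ) l n le_rfl β α *
          ∑ t, M k l (α t) (β t)) := by
      intro α β
      simp only [playProb, reach, Strategy₂.swap, Finset.prod_mul_distrib, Fin.eta]
      ring
    simp_rw [e, Finset.sum_add_distrib, ← Finset.mul_sum]
    rw [sum_reach_mul_reach, sum_reach_mul_sum, mul_one]
    simp_rw [Finset.mul_sum]
    refine congrArg (p k * (ν l * q.1 l) + ·) ?_
    refine Finset.sum_congr rfl fun t _ => Finset.sum_congr rfl fun hA _ =>
      Finset.sum_congr rfl fun hB _ => Finset.sum_congr rfl fun a _ =>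
      Finset.sum_congr rfl fun b _ => ?_
    simp only [planOf₂, planOf, Strategy₂.swap, Fin.eta]
    ring
  unfold dualPayoff₂ expect planPayoff stagePayoff
  simp_rw [key]
  rw [Finset.sum_comm]
  refine Finset.sum_congr rfl fun l _ => ?_
  rw [Finset.sum_add_distrib, ← Finset.sum_mul, hp.2, one_mul]
  refine congrArg (ν l * q.1 l + ·) ?_
  simp_rw [Finset.sum_mul]
  rw [Finset.sum_comm]
  refine Finset.sum_congr rfl fun t _ => ?_
  rw [Finset.sum_comm]
  refine Finset.sum_congr rfl fun hA _ => ?_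
  rw [Finset.sum_comm]
  refine Finset.sum_congr rfl fun hB _ => ?_
  rw [Finset.sum_comm (s := (Finset.univ : Finset B))]
  exact Finset.sum_congr rfl fun k _ => Finset.sum_comm

end Payoff

/-! ### Feasible points and guaranteed payoffs -/

section LinearProgram

variable {n : ℕ} {K L A B : Type*} [Fintype A] [Fintype B]

/-- Telescoping: local inequalities between the potentials `u` along a realization plan `y` of
player 2 bound the total payoff `c` from below. -/
theorem root_mul_le_sum_of_step (hn : 0 < n)
    (y c : (t : Fin n) → (Fin t → A) → (Fin t → B) → B → ℝ)
    (u : (t : Fin n) → (Fin t → A) → (Fin t → B) → A → B → ℝ) (r : ℝ)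
    (terminal : ∀ t : Fin n, (t : ℕ) + 1 = n → ∀ hA hB a b, u t hA hB a b = 0)
    (root : r ≤ ∑ b, (c ⟨0, hn⟩ Fin.elim0 Fin.elim0 b + ∑ a, u ⟨0, hn⟩ Fin.elim0 Fin.elim0 a b) *
      y ⟨0, hn⟩ Fin.elim0 Fin.elim0 b)
    (step : ∀ (t : ℕ) (h : t + 1 < n) (hA : Fin t → A) (hB : Fin t → B) a b,
      u ⟨t, by omega⟩ hA hB a b * y ⟨t, by omega⟩ hA hB b ≤
        ∑ b', (c ⟨t + 1, h⟩ (Fin.snoc hA a) (Fin.snoc hB b) b' +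
          ∑ a', u ⟨t + 1, h⟩ (Fin.snoc hA a) (Fin.snoc hB b) a' b') *
            y ⟨t + 1, h⟩ (Fin.snoc hA a) (Fin.snoc hB b) b') :
    r ≤ ∑ t, ∑ hA, ∑ hB, ∑ b, c t hA hB b * y t hA hB b := by
  -- After stage `m`, `r` is bounded by the payoffs of stages `0` to `m` plus the potentials left
  -- over, weighted by `y`. At the last stage the potentials vanish.
  have key : ∀ (m : ℕ) (hm : m < n), r ≤
      ∑ t : Fin (m + 1), ∑ hA : Fin t → A, ∑ hB : Fin t → B, ∑ b,
        c ⟨t, by omega⟩ hA hB b * y ⟨t, by omega⟩ hA hB b +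
      ∑ hA : Fin m → A, ∑ hB : Fin m → B, ∑ b,
        (∑ a, u ⟨m, hm⟩ hA hB a b) * y ⟨m, hm⟩ hA hB b := by
    intro m
    induction m with
    | zero =>
      intro hm
      refine root.trans_eq ?_
      simp_rw [add_mul, Finset.sum_add_distrib]
      rw [Fin.sum_univ_succ, Fin.sum_univ_zero, add_zero]
      refine congrArg₂ (· + ·) ?_ ?_
      · exact (sum_hist_zero fun hA hB => ∑ b, c ⟨0, hn⟩ hA hB b * y ⟨0, hn⟩ hA hB b).symm
      · exact (sum_hist_zero fun hA hB =>
          ∑ b, (∑ a, u ⟨0, hn⟩ hA hB a b) * y ⟨0, hn⟩ hA hB b).symm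
    | succ m ih =>
      intro hm
      refine (ih (by omega)).trans ?_
      rw [Fin.sum_univ_castSucc (n := m + 1), add_assoc]
      refine add_le_add le_rfl ?_
      refine le_trans ?_ (Finset.sum_add_distrib (s := (Finset.univ : Finset (Fin (m + 1) → A)))
        (f := fun hA => ∑ hB : Fin (m + 1) → B, ∑ b, c ⟨m + 1, hm⟩ hA hB b * y ⟨m + 1, hm⟩ hA hB b)
        (g := fun hA => ∑ hB : Fin (m + 1) → B, ∑ b,
          (∑ a, u ⟨m + 1, hm⟩ hA hB a b) * y ⟨m + 1, hm⟩ hA hB b)).le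
      simp_rw [← Finset.sum_add_distrib, ← add_mul]
      rw [sum_hist_succ]
      refine Finset.sum_le_sum fun hA _ => ?_
      simp_rw [sum_hist_succ]
      refine le_trans ?_ Finset.sum_comm.le
      refine Finset.sum_le_sum fun hB _ => ?_
      refine le_trans ?_ Finset.sum_comm.le
      refine Finset.sum_le_sum fun b _ => ?_
      rw [Finset.sum_mul]
      exact Finset.sum_le_sum fun a _ => step m hm hA hB a b
  obtain ⟨N, rfl⟩ : ∃ N, n = N + 1 := ⟨n - 1, by omega⟩
  refine (key N (by omega)).trans_eq ?_
  simp [terminal ⟨N, by omega⟩ rfl]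

/-- The optimal continuation payoff of player 2 with `j` stages to go, by backward induction. -/
def contValue [Nonempty B] (c : (t : ℕ) → (Fin t → A) → (Fin t → B) → B → ℝ) :
    ℕ → (t : ℕ) → (Fin t → A) → (Fin t → B) → ℝ
  | 0, _, _, _ => 0
  | j + 1, t, hA, hB => Finset.univ.inf' Finset.univ_nonempty fun b =>
      c t hA hB b + ∑ a, contValue c j (t + 1) (Fin.snoc hA a) (Fin.snoc hB b)

theorem contValue_le [Nonempty B] (c : (t : ℕ) → (Fin t → A) → (Fin t → B) → B → ℝ) (j t : ℕ)
    (hA : Fin t → A) (hB : Fin t → B) (b : B) :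
    contValue c (j + 1) t hA hB ≤
      c t hA hB b + ∑ a, contValue c j (t + 1) (Fin.snoc hA a) (Fin.snoc hB b) :=
  Finset.inf'_le _ (Finset.mem_univ b)

theorem exists_contValue_eq [Nonempty B] (c : (t : ℕ) → (Fin t → A) → (Fin t → B) → B → ℝ)
    (j t : ℕ) (hA : Fin t → A) (hB : Fin t → B) :
    ∃ b, contValue c (j + 1) t hA hB =
      c t hA hB b + ∑ a, contValue c j (t + 1) (Fin.snoc hA a) (Fin.snoc hB b) := by
  obtain ⟨b, -, hb⟩ := Finset.exists_mem_eq_inf' Finset.univ_nonempty fun b =>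
      c t hA hB b + ∑ a, contValue c j (t + 1) (Fin.snoc hA a) (Fin.snoc hB b)
  exact ⟨b, hb⟩

variable [Fintype K] [Fintype L]

/-- The realization plans of player 2 in the type 2 dual game, with the law of his type. -/
def dualPlans (n : ℕ) (L A B : Type*) [Fintype L] [Fintype B] :
    Set ((L → ℝ) × ((t : Fin n) → L → (Fin t → A) → (Fin t → B) → B → ℝ)) :=
  {y | y.1 ∈ stdSimplex ℝ L ∧ IsPlan₂ y.1 y.2}

/-- A feasible point of the linear program guarantees its objective value. -/
theorem DualFeasible₁.le_planPayoff (hn : 0 < n) {M : K → L → A → B → ℝ} {p : K → ℝ} {ν : L → ℝ}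
    {x : (t : Fin n) → K → (Fin t → A) → (Fin t → B) → A → ℝ}
    {u : (t : Fin n) → L → (Fin t → A) → (Fin t → B) → A → B → ℝ} {u₀ : L → ℝ} {v : ℝ}
    (h : DualFeasible₁ M p ν x u u₀ v)
    {y : (L → ℝ) × ((t : Fin n) → L → (Fin t → A) → (Fin t → B) → B → ℝ)}
    (hy : y ∈ dualPlans n L A B) : v ≤ planPayoff M ν x y := by
  obtain ⟨⟨hq₀, hq₁⟩, hy⟩ := hy
  have e : v = ∑ l, v * y.1 l := by rw [← Finset.mul_sum, hq₁, mul_one]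
  rw [e]
  refine Finset.sum_le_sum fun l _ => ?_
  have key : u₀ l * y.1 l ≤
      ∑ t, ∑ hA, ∑ hB, ∑ b, stagePayoff M x l t hA hB b * y.2 t l hA hB b := by
    refine root_mul_le_sum_of_step hn (fun t => y.2 t l) (stagePayoff M x l) (fun t => u t l)
      _ (fun t ht => h.terminal t ht l) ?_ ?_
    · rw [← hy.root hn, Finset.mul_sum]
      exact Finset.sum_le_sum fun b _ =>
        mul_le_mul_of_nonneg_right (h.root hn l b) (hy.nonneg ..)
    · intro t ht hA hB a b
      rw [← hy.step t ht l hA hB a b, Finset.mul_sum]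
      exact Finset.sum_le_sum fun b' _ =>
        mul_le_mul_of_nonneg_right (h.step t ht l hA hB a b b') (hy.nonneg ..)
  nlinarith [mul_le_mul_of_nonneg_right (h.top l) (hq₀ l)]

/-- If a plan of player 1 guarantees `v`, it is part of a feasible point with objective `v`. -/
theorem exists_dualFeasible₁ [Nonempty B] (hn : 0 < n) {M : K → L → A → B → ℝ} {p : K → ℝ}
    {ν : L → ℝ} {x : (t : Fin n) → K → (Fin t → A) → (Fin t → B) → A → ℝ} (hx : IsPlan₁ p x)
    {v : ℝ} (hv : ∀ y ∈ dualPlans n L A B, v ≤ planPayoff M ν x y) :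
    ∃ u u₀, DualFeasible₁ M p ν x u u₀ v := by
  classical
  -- Extended by zero beyond the horizon, since `contValue` recurses over all natural stages.
  set c : L → (t : ℕ) → (Fin t → A) → (Fin t → B) → B → ℝ := fun l t hA hB b =>
    if h : t < n then stagePayoff M x l ⟨t, h⟩ hA hB b else 0
  have hc : ∀ l (t : ℕ) (h : t < n) hA hB b,
      c l t hA hB b = stagePayoff M x l ⟨t, h⟩ hA hB b := fun l t h hA hB b => dif_pos h
  -- The continuation value after `(a, b)`. It is summed, not averaged, over `a`, because the stage
  -- payoffs already carry player 1's weights through `x`.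
  set u : (t : Fin n) → L → (Fin t → A) → (Fin t → B) → A → B → ℝ := fun t l hA hB a b =>
    contValue (c l) (n - (t + 1)) (t + 1) (Fin.snoc hA a) (Fin.snoc hB b) with hu_def
  have hu : ∀ (t : ℕ) (h : t < n) l (hA : Fin t → A) (hB : Fin t → B) a b, u ⟨t, h⟩ l hA hB a b =
    contValue (c l) (n - (t + 1)) (t + 1) (Fin.snoc hA a) (Fin.snoc hB b) :=
    fun _ _ _ _ _ _ _ => rfl
  have term : ∀ t : Fin n, (t : ℕ) + 1 = n → ∀ l hA hB a b, u t l hA hB a b = 0 := by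
    intro t ht l hA hB a b
    have : n - ((t : ℕ) + 1) = 0 := by omega
    simp only [hu_def, this, contValue]
  have val : ∀ (t : ℕ) (h : t < n) l (hA : Fin t → A) (hB : Fin t → B) b,
      contValue (c l) (n - t) t hA hB ≤
        stagePayoff M x l ⟨t, h⟩ hA hB b + ∑ a, u ⟨t, h⟩ l hA hB a b := by
    intro t h l hA hB b
    rw [show n - t = n - (t + 1) + 1 by omega, ← hc]
    exact contValue_le (c l) _ t hA hB b
  have opt : ∀ (t : Fin n) l (hA : Fin t → A) (hB : Fin t → B), ∃ b,
      contValue (c l) (n - t) t hA hB =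
        stagePayoff M x l t hA hB b + ∑ a, u t l hA hB a b := by
    intro t l hA hB
    rw [show n - (t : ℕ) = n - (t + 1) + 1 by omega]
    obtain ⟨b, hb⟩ := exists_contValue_eq (c l) (n - (t + 1)) t hA hB
    exact ⟨b, by rw [hb, hc l t t.isLt]⟩
  choose β hβ using opt
  -- The pure best reply to `x`, taken with the point mass at `l`, tests the top constraint of type
  -- `l`.
  let τ : Strategy₂ n L A B := fun t l hA hB =>
    ⟨Pi.single (β t l hA hB) 1, single_mem_stdSimplex ℝ _⟩
  refine ⟨u, fun l => contValue (c l) n 0 Fin.elim0 Fin.elim0, hx, term, fun l => ?_,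
    fun h l b => val 0 h l _ _ b, fun t h l hA hB a b b' => val (t + 1) h l _ _ b'⟩
  let q : L → ℝ := Pi.single l 1
  have hq : q ∈ stdSimplex ℝ L := single_mem_stdSimplex ℝ l
  have hy := isPlan₂_planOf₂ (A := A) hq.1 τ
  refine (hv (q, planOf₂ q τ) ⟨hq, hy⟩).trans ?_
  have zero : ∀ t l' hA hB b, b ≠ β t l' hA hB ∨ l' ≠ l → planOf₂ q τ t l' hA hB b = 0 := by
    rintro t l' hA hB b (hb | hl)
    · simp [planOf₂, planOf, Strategy₂.swap, τ, hb]
    · simp [planOf₂, planOf, q, hl]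
  have best : ∀ (t : Fin n) hA hB, ∑ b, (stagePayoff M x l t hA hB b + ∑ a, u t l hA hB a b) *
      planOf₂ q τ t l hA hB b =
        contValue (c l) (n - t) t hA hB * ∑ b, planOf₂ q τ t l hA hB b := by
    intro t hA hB
    rw [Finset.mul_sum]
    refine Finset.sum_congr rfl fun b _ => ?_
    by_cases hb : b = β t l hA hB
    · rw [hβ, hb]
    · rw [zero t l hA hB b (Or.inl hb), mul_zero, mul_zero]
  -- Along the best reply the local inequalities are equalities, so telescoping also applies to the
  -- negated payoffs and potentials and bounds the payoff from above by the continuation value at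
  -- the root.
  have key : -contValue (c l) n 0 Fin.elim0 Fin.elim0 ≤ ∑ t, ∑ hA, ∑ hB, ∑ b,
      (-stagePayoff M x l t hA hB b) * planOf₂ q τ t l hA hB b := by
    have neg : ∀ (t : Fin n) hA hB, ∑ b, (-stagePayoff M x l t hA hB b +
        ∑ a, -u t l hA hB a b) * planOf₂ q τ t l hA hB b =
        -(contValue (c l) (n - t) t hA hB * ∑ b, planOf₂ q τ t l hA hB b) := by
      intro t hA hB
      simp_rw [Finset.sum_neg_distrib, ← neg_add, neg_mul, Finset.sum_neg_distrib, best]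
    refine root_mul_le_sum_of_step hn (fun t => planOf₂ q τ t l)
      (fun t hA hB b => -stagePayoff M x l t hA hB b) (fun t hA hB a b => -u t l hA hB a b) _
      (fun t ht hA hB a b => by rw [term t ht, neg_zero]) ?_ ?_
    · refine Eq.ge ((neg _ _ _).trans ?_)
      rw [hy.root hn]
      simp [q]
    · intro t ht hA hB a b
      refine Eq.ge ((neg _ _ _).trans ?_)
      rw [hy.step t ht, hu, neg_mul]
  simp_rw [neg_mul, Finset.sum_neg_distrib, neg_le_neg_iff] at key
  unfold planPayoff
  rw [Finset.sum_eq_single l]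
  · have e : q l = 1 := by simp [q]
    dsimp only
    rw [e, mul_one, add_comm]
    exact add_le_add_left key _
  · intro l' _ hl
    have e : q l' = 0 := by simp [q, hl]
    simp [e, zero _ _ _ _ _ (Or.inr hl)]
  · simp

end LinearProgram

/-! ### Saddle points, security levels and security strategies -/

section ZeroSum

variable {S₁ S₂ : Type*} {γ : S₁ → S₂ → ℝ} {v : ℝ}

theorem isSecurityLevel₁_of_saddle (h₁ : ∃ s₁, ∀ s₂, v ≤ γ s₁ s₂) (h₂ : ∃ s₂, ∀ s₁, γ s₁ s₂ ≤ v) :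
    IsSecurityLevel₁ γ v := by
  obtain ⟨a, ha⟩ := h₁
  obtain ⟨b, hb⟩ := h₂
  refine ⟨⟨a, ⟨b, le_antisymm (hb a) (ha b)⟩, Set.forall_mem_range.2 ha⟩, ?_⟩
  rintro g ⟨s₁, hg⟩
  exact (hg.2 ⟨b, rfl⟩).trans (hb s₁)

theorem isSecurityLevel₂_of_saddle (h₁ : ∃ s₁, ∀ s₂, v ≤ γ s₁ s₂) (h₂ : ∃ s₂, ∀ s₁, γ s₁ s₂ ≤ v) :
    IsSecurityLevel₂ γ v := by
  obtain ⟨a, ha⟩ := h₁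
  obtain ⟨b, hb⟩ := h₂
  refine ⟨⟨b, ⟨a, le_antisymm (hb a) (ha b)⟩, Set.forall_mem_range.2 hb⟩, ?_⟩
  rintro g ⟨s₂, hg⟩
  exact (ha s₂).trans (hg.2 ⟨a, rfl⟩)

/-- Reduces security strategies to those that guarantee `v`; the worst case is then attained at the
opponent's saddle strategy. -/
theorem isSecurityStrategy₁_iff_of_saddle (h₁ : ∃ s₁, ∀ s₂, v ≤ γ s₁ s₂)
    (h₂ : ∃ s₂, ∀ s₁, γ s₁ s₂ ≤ v) (s₁ : S₁) :
    IsSecurityStrategy₁ γ s₁ ↔ ∀ s₂, v ≤ γ s₁ s₂ := by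
  have hv := isSecurityLevel₁_of_saddle h₁ h₂
  constructor
  · rintro ⟨w, hw, hs⟩ s₂
    rw [hv.unique hw]
    exact hs.2 ⟨s₂, rfl⟩
  · intro h
    obtain ⟨b, hb⟩ := h₂
    exact ⟨v, hv, ⟨b, le_antisymm (hb s₁) (h b)⟩, Set.forall_mem_range.2 h⟩

theorem isSecurityStrategy₂_iff_of_saddle (h₁ : ∃ s₁, ∀ s₂, v ≤ γ s₁ s₂)
    (h₂ : ∃ s₂, ∀ s₁, γ s₁ s₂ ≤ v) (s₂ : S₂) :
    IsSecurityStrategy₂ γ s₂ ↔ ∀ s₁, γ s₁ s₂ ≤ v := by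
  have hv := isSecurityLevel₂_of_saddle h₁ h₂
  constructor
  · rintro ⟨w, hw, hs⟩ s₁
    rw [hv.unique hw]
    exact hs.2 ⟨s₁, rfl⟩
  · intro h
    obtain ⟨a, ha⟩ := h₁
    exact ⟨v, hv, ⟨a, le_antisymm (h a) (ha s₂)⟩, Set.forall_mem_range.2 h⟩

end ZeroSum

/-! ### Minimax over realization plans -/

section Minimax

variable {n : ℕ} {K L A B : Type*}

/-- Only affine in `x`: the regret term is constant in it, whence the weights must sum to one. In
`y` the payoff is linear, since there the regret is weighted by the law of the type. -/
theorem planPayoff_add_smul_left [Fintype K] [Fintype L] [Fintype A] [Fintype B]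
    (M : K → L → A → B → ℝ) (ν : L → ℝ)
    (x x' : (t : Fin n) → K → (Fin t → A) → (Fin t → B) → A → ℝ)
    (y : (L → ℝ) × ((t : Fin n) → L → (Fin t → A) → (Fin t → B) → B → ℝ)) {r s : ℝ}
    (hrs : r + s = 1) :
    planPayoff M ν (r • x + s • x') y = r * planPayoff M ν x y + s * planPayoff M ν x' y := by
  have e : ∀ l t hA hB b, stagePayoff M (r • x + s • x') l t hA hB b =
      r * stagePayoff M x l t hA hB b + s * stagePayoff M x' l t hA hB b := by
    intro l t hA hB b
    simp only [stagePayoff, Pi.add_apply, Pi.smul_apply, smul_eq_mul, mul_add,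
      Finset.sum_add_distrib, Finset.mul_sum, mul_left_comm]
  have e' : ∀ z : ℝ, z = r * z + s * z := fun z => by rw [← add_mul, hrs, one_mul]
  simp only [planPayoff, e, add_mul, Finset.sum_add_distrib, mul_add, Finset.mul_sum, mul_assoc]
  rw [← Finset.mul_sum, ← Finset.mul_sum]
  linear_combination e' (∑ l, ν l * y.1 l)

theorem planPayoff_add_smul_right [Fintype K] [Fintype L] [Fintype A] [Fintype B]
    (M : K → L → A → B → ℝ) (ν : L → ℝ)
    (x : (t : Fin n) → K → (Fin t → A) → (Fin t → B) → A → ℝ)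
    (y y' : (L → ℝ) × ((t : Fin n) → L → (Fin t → A) → (Fin t → B) → B → ℝ)) (r s : ℝ) :
    planPayoff M ν x (r • y + s • y') = r * planPayoff M ν x y + s * planPayoff M ν x y' := by
  simp only [planPayoff, Prod.fst_add, Prod.snd_add, Prod.smul_fst, Prod.smul_snd, Pi.add_apply,
    Pi.smul_apply, smul_eq_mul, mul_add, Finset.sum_add_distrib, Finset.mul_sum, mul_left_comm]
  ring

theorem convex_setOf_isPlan₁ [Fintype A] (p : K → ℝ) :
    Convex ℝ {x : (t : Fin n) → K → (Fin t → A) → (Fin t → B) → A → ℝ | IsPlan₁ p x} := by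
  intro x hx x' hx' r s hr hs hrs
  refine ⟨fun t k hA hB a => add_nonneg (mul_nonneg hr (hx.nonneg ..))
    (mul_nonneg hs (hx'.nonneg ..)), fun h k => ?_, fun t h k hA hB a b => ?_⟩
  · simp only [Pi.add_apply, Pi.smul_apply, smul_eq_mul, Finset.sum_add_distrib, ← Finset.mul_sum,
      IsPlan₁.root hx, IsPlan₁.root hx']
    rw [← add_mul, hrs, one_mul]
  · simp only [Pi.add_apply, Pi.smul_apply, smul_eq_mul, Finset.sum_add_distrib, ← Finset.mul_sum,
      IsPlan₁.step hx, IsPlan₁.step hx']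

theorem convex_dualPlans [Fintype L] [Fintype B] : Convex ℝ (dualPlans n L A B) := by
  rintro ⟨q, y⟩ ⟨hq, hy⟩ ⟨q', y'⟩ ⟨hq', hy'⟩ r s hr hs hrs
  refine ⟨convex_stdSimplex ℝ L hq hq' hr hs hrs, fun t l hA hB b =>
    add_nonneg (mul_nonneg hr (hy.nonneg ..)) (mul_nonneg hs (hy'.nonneg ..)),
    fun h l => ?_, fun t h l hA hB a b => ?_⟩
  · simp only [Prod.fst_add, Prod.snd_add, Prod.smul_fst, Prod.smul_snd, Pi.add_apply,
      Pi.smul_apply, smul_eq_mul, Finset.sum_add_distrib, ← Finset.mul_sum, hy.root, hy'.root]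
  · simp only [Prod.snd_add, Prod.smul_snd, Pi.add_apply, Pi.smul_apply, smul_eq_mul,
      Finset.sum_add_distrib, ← Finset.mul_sum, hy.step, hy'.step]

/-- Lets a saddle point over plans be pulled back to behavior strategies. -/
theorem range_planOf [Fintype A] [Nonempty A] {p : K → ℝ} (hp : ∀ k, 0 ≤ p k) :
    Set.range (fun σ : Strategy₁ n K A B => planOf p σ) = {x | IsPlan₁ p x} := by
  ext x
  constructor
  · rintro ⟨σ, rfl⟩
    exact isPlan₁_planOf hp σ
  · exact fun hx => hx.exists_planOf_eq

theorem range_planOf₂ [Fintype L] [Fintype B] [Nonempty B] :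
    Set.range (fun s : stdSimplex ℝ L × Strategy₂ n L A B => (s.1.1, planOf₂ s.1.1 s.2)) =
      dualPlans n L A B := by
  ext ⟨q, y⟩
  constructor
  · rintro ⟨s, hs⟩
    rw [← hs]
    exact ⟨s.1.2, isPlan₂_planOf₂ s.1.2.1 s.2⟩
  · rintro ⟨hq, hy⟩
    obtain ⟨τ, hτ⟩ := hy.exists_planOf₂_eq
    exact ⟨(⟨q, hq⟩, τ), Prod.ext rfl hτ⟩

theorem isCompact_setOf_isPlan₁ [Fintype A] [Nonempty A] {p : K → ℝ} (hp : ∀ k, 0 ≤ p k) :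
    IsCompact {x : (t : Fin n) → K → (Fin t → A) → (Fin t → B) → A → ℝ | IsPlan₁ p x} := by
  rw [← range_planOf hp]
  exact isCompact_range (continuous_planOf.comp (by fun_prop : Continuous fun σ => (p, σ)))

theorem isCompact_dualPlans [Fintype L] [Fintype B] [Nonempty B]
    : IsCompact (dualPlans n L A B) := by
  rw [← range_planOf₂]
  have h : Continuous fun s : stdSimplex ℝ L × Strategy₂ n L A B => (s.1.1, s.2) := by fun_prop
  exact isCompact_range ((continuous_fst.comp h).prodMk (continuous_planOf₂.comp h))

/-- The type 2 dual game has a saddle point. -/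
theorem exists_saddle_dualPayoff₂ [Fintype K] [Fintype L] [Fintype A] [Fintype B] [Nonempty L]
    [Nonempty A] [Nonempty B] (M : K → L → A → B → ℝ)
    {p : K → ℝ} (hp : p ∈ stdSimplex ℝ K) (ν : L → ℝ) :
    ∃ v, (∃ σ : Strategy₁ n K A B, ∀ s, v ≤ dualPayoff₂ M p ν σ s) ∧
      ∃ s : stdSimplex ℝ L × Strategy₂ n L A B, ∀ σ, dualPayoff₂ M p ν σ s ≤ v := by
  -- The minimizing player 2 takes the convex, lower semicontinuous variable of Sion's theorem.
  obtain ⟨y, hy, x, hx, hxy⟩ := Sion.exists_isSaddlePointOn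
    (X := dualPlans n L A B)
    (Y := {x : (t : Fin n) → K → (Fin t → A) → (Fin t → B) → A → ℝ | IsPlan₁ p x})
    (f := fun y x => planPayoff M ν x y)
    (by rw [← range_planOf₂]; exact Set.range_nonempty _)
    convex_dualPlans isCompact_dualPlans
    (fun x _ => by
      refine Continuous.continuousOn ?_ |>.lowerSemicontinuousOn
      unfold planPayoff
      fun_prop)
    (fun x _ => by
      refine ConvexOn.quasiconvexOn ⟨convex_dualPlans, fun y _ y' _ r s _ _ _ => ?_⟩
      exact (planPayoff_add_smul_right ..).le)
    (convex_setOf_isPlan₁ p)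
    (by rw [← range_planOf hp.1]; exact Set.range_nonempty _)
    (isCompact_setOf_isPlan₁ hp.1)
    (fun y _ => by
      refine Continuous.continuousOn ?_ |>.upperSemicontinuousOn
      unfold planPayoff stagePayoff
      fun_prop)
    (fun y _ => by
      refine ConcaveOn.quasiconcaveOn ⟨convex_setOf_isPlan₁ p, fun x _ x' _ r s _ _ hrs => ?_⟩
      exact (planPayoff_add_smul_left M ν x x' y hrs).ge)
  obtain ⟨σ, rfl⟩ := IsPlan₁.exists_planOf_eq hx
  rw [← range_planOf₂] at hy
  obtain ⟨s, rfl⟩ := hy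
  refine ⟨dualPayoff₂ M p ν σ s, ⟨σ, fun s' => ?_⟩, s, fun σ' => ?_⟩
  · rw [dualPayoff₂_eq_planPayoff M hp, dualPayoff₂_eq_planPayoff M hp]
    exact hxy _ (range_planOf₂.subset ⟨s', rfl⟩) _ hx
  · rw [dualPayoff₂_eq_planPayoff M hp, dualPayoff₂_eq_planPayoff M hp]
    exact hxy _ (range_planOf₂.subset ⟨s, rfl⟩) _ (isPlan₁_planOf hp.1 σ')

/-- A feasible point of the linear program yields a strategy guaranteeing its objective value. -/
theorem DualFeasible₁.exists_strategy [Fintype K] [Fintype L] [Fintype A] [Fintype B] [Nonempty A]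
    (hn : 0 < n) {M : K → L → A → B → ℝ}
    {p : K → ℝ} (hp : p ∈ stdSimplex ℝ K) {ν : L → ℝ}
    {x : (t : Fin n) → K → (Fin t → A) → (Fin t → B) → A → ℝ}
    {u : (t : Fin n) → L → (Fin t → A) → (Fin t → B) → A → B → ℝ} {u₀ : L → ℝ} {v : ℝ}
    (h : DualFeasible₁ M p ν x u u₀ v) :
    ∃ σ : Strategy₁ n K A B, (∀ s, v ≤ dualPayoff₂ M p ν σ s) ∧
      ∀ k, 0 < p k → ∀ a, (σ ⟨0, hn⟩ k Fin.elim0 Fin.elim0).1 a =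
        x ⟨0, hn⟩ k Fin.elim0 Fin.elim0 a / p k := by
  obtain ⟨σ, rfl⟩ := h.plan.exists_planOf_eq
  refine ⟨σ, fun s => ?_, fun k hk a => ?_⟩
  · rw [dualPayoff₂_eq_planPayoff M hp]
    exact h.le_planPayoff hn ⟨s.1.2, isPlan₂_planOf₂ s.1.2.1 s.2⟩
  · rw [planOf_zero, mul_div_cancel_left₀ _ hk.ne']

/-- A strategy guaranteeing `v` comes from a feasible point with objective value `v`. -/
theorem exists_dualFeasible₁_of_strategy [Fintype K] [Fintype L] [Fintype A] [Fintype B]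
    [Nonempty B] (hn : 0 < n) {M : K → L → A → B → ℝ}
    {p : K → ℝ} (hp : p ∈ stdSimplex ℝ K) {ν : L → ℝ} {v : ℝ} {σ : Strategy₁ n K A B}
    (hσ : ∀ s, v ≤ dualPayoff₂ M p ν σ s) :
    ∃ x u u₀, DualFeasible₁ M p ν x u u₀ v ∧
      ∀ k, 0 < p k → ∀ a, (σ ⟨0, hn⟩ k Fin.elim0 Fin.elim0).1 a =
        x ⟨0, hn⟩ k Fin.elim0 Fin.elim0 a / p k := by
  obtain ⟨u, u₀, h⟩ := exists_dualFeasible₁ (M := M) (ν := ν) (v := v) hn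
    (isPlan₁_planOf hp.1 σ) (by
      rw [← range_planOf₂]
      rintro _ ⟨s, rfl⟩
      rw [← dualPayoff₂_eq_planPayoff M hp]
      exact hσ s)
  exact ⟨_, u, u₀, h, fun k hk a => by rw [planOf_zero, mul_div_cancel_left₀ _ hk.ne']⟩

end Minimax

/-! ### The type 1 dual game by exchanging the players -/

section Swap

variable {n : ℕ} {K L A B : Type*}

/-- The type 1 dual game is the type 2 dual game with the players exchanged. -/
theorem dualPayoff₁_eq_neg_dualPayoff₂ [Fintype K] [Fintype L] [Fintype A] [Fintype B]
    (M : K → L → A → B → ℝ) (μ : K → ℝ) (q : L → ℝ)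
    (p : stdSimplex ℝ K) (σ : Strategy₁ n K A B) (τ : Strategy₂ n L A B) :
    dualPayoff₁ M μ q (p, σ) τ = -dualPayoff₂ (n := n) (fun l k b a => -M k l a b) q (-μ)
      (Strategy₂.swap τ) (p, fun t k hB hA => σ t k hA hB) := by
  unfold dualPayoff₁ dualPayoff₂ expect
  rw [Finset.sum_comm, ← Finset.sum_neg_distrib]
  refine Finset.sum_congr rfl fun l _ => ?_
  rw [← Finset.sum_neg_distrib]
  refine Finset.sum_congr rfl fun k _ => ?_
  rw [Finset.sum_comm, ← Finset.sum_neg_distrib]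
  refine Finset.sum_congr rfl fun β _ => ?_
  rw [← Finset.sum_neg_distrib]
  refine Finset.sum_congr rfl fun α _ => ?_
  simp only [playProb, Strategy₂.swap, Finset.sum_neg_distrib, Pi.neg_apply, ← neg_add, mul_neg,
    neg_neg, mul_comm (p.1 k), mul_comm ((σ _ _ _ _).1 _)]

/-- Negating payoffs, regret and potentials reverses every inequality, while the plan is only
reindexed; the objective `v` becomes `-v`. -/
theorem DualFeasible₂.swap [Fintype L] [Fintype B] {M : K → L → A → B → ℝ} {μ : K → ℝ} {q : L → ℝ}
    {y : (t : Fin n) → L → (Fin t → A) → (Fin t → B) → B → ℝ}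
    {w : (t : Fin n) → K → (Fin t → A) → (Fin t → B) → A → B → ℝ} {w₀ : K → ℝ} {v : ℝ}
    (h : DualFeasible₂ M μ q y w w₀ v) :
    DualFeasible₁ (n := n) (fun l k b a => -M k l a b) q (-μ) (fun t l hB hA b => y t l hA hB b)
      (fun t k hB hA b a => -w t k hA hB a b) (-w₀) (-v) where
  plan := ⟨fun t l hB hA b => h.plan.nonneg t l hA hB b, fun h' l => h.plan.root h' l,
    fun t h' l hB hA b a => h.plan.step t h' l hA hB a b⟩
  terminal t ht k hB hA b a := by rw [h.terminal t ht, neg_zero]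
  top k := by
    have := h.top k
    simp only [Pi.neg_apply]
    linarith
  root hn k a := by
    have := h.root hn k a
    simp only [neg_mul, Finset.sum_neg_distrib, Pi.neg_apply]
    linarith
  step t ht k hB hA b a a' := by
    have := h.step t ht k hA hB a b a'
    simp only [neg_mul, Finset.sum_neg_distrib]
    linarith

theorem DualFeasible₁.swap [Fintype L] [Fintype B] {M : K → L → A → B → ℝ} {μ : K → ℝ} {q : L → ℝ}
    {x : (t : Fin n) → L → (Fin t → B) → (Fin t → A) → B → ℝ}
    {u : (t : Fin n) → K → (Fin t → B) → (Fin t → A) → B → A → ℝ} {u₀ : K → ℝ} {v : ℝ}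
    (h : DualFeasible₁ (n := n) (fun l k b a => -M k l a b) q (-μ) x u u₀ (-v)) :
    DualFeasible₂ (n := n) M μ q (fun t l hA hB b => x t l hB hA b)
      (fun t k hA hB a b => -u t k hB hA b a) (-u₀) v where
  plan := ⟨fun t l hA hB b => h.plan.nonneg t l hB hA b, fun h' l => h.plan.root h' l,
    fun t h' l hA hB a b => h.plan.step t h' l hB hA b a⟩
  terminal t ht k hA hB a b := by rw [h.terminal t ht, neg_zero]
  top k := by
    have := h.top k
    simp only [Pi.neg_apply] at this ⊢
    linarith
  root hn k a := by
    have := h.root hn k a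
    simp only [neg_mul, Finset.sum_neg_distrib, Pi.neg_apply] at this ⊢
    linarith
  step t ht k hA hB a b a' := by
    have := h.step t ht k hB hA b a a'
    simp only [neg_mul, Finset.sum_neg_distrib] at this ⊢
    linarith

/-- The type 1 dual game has a saddle point. -/
theorem exists_saddle_dualPayoff₁ [Fintype K] [Fintype L] [Fintype A] [Fintype B] [Nonempty K]
    [Nonempty A] [Nonempty B] (M : K → L → A → B → ℝ)
    (μ : K → ℝ) {q : L → ℝ} (hq : q ∈ stdSimplex ℝ L) :
    ∃ v, (∃ s : stdSimplex ℝ K × Strategy₁ n K A B, ∀ τ, v ≤ dualPayoff₁ M μ q s τ) ∧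
      ∃ τ : Strategy₂ n L A B, ∀ s, dualPayoff₁ M μ q s τ ≤ v := by
  obtain ⟨v, ⟨τ, hτ⟩, ⟨p, σ⟩, hσ⟩ :=
    exists_saddle_dualPayoff₂ (n := n) (fun l k b a => -M k l a b) hq (-μ)
  refine ⟨-v, ⟨(p, fun t k hA hB => σ t k hB hA), fun τ' => ?_⟩,
    fun t l hA hB => τ t l hB hA, fun s => ?_⟩
  · rw [dualPayoff₁_eq_neg_dualPayoff₂]
    exact neg_le_neg (hσ _)
  · rw [dualPayoff₁_eq_neg_dualPayoff₂]
    exact neg_le_neg (hτ _)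

theorem DualFeasible₂.exists_strategy [Fintype K] [Fintype L] [Fintype A] [Fintype B] [Nonempty B]
    (hn : 0 < n) {M : K → L → A → B → ℝ}
    {μ : K → ℝ} {q : L → ℝ} (hq : q ∈ stdSimplex ℝ L)
    {y : (t : Fin n) → L → (Fin t → A) → (Fin t → B) → B → ℝ}
    {w : (t : Fin n) → K → (Fin t → A) → (Fin t → B) → A → B → ℝ} {w₀ : K → ℝ} {v : ℝ}
    (h : DualFeasible₂ M μ q y w w₀ v) :
    ∃ τ : Strategy₂ n L A B, (∀ s, dualPayoff₁ M μ q s τ ≤ v) ∧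
      ∀ l, 0 < q l → ∀ b, (τ ⟨0, hn⟩ l Fin.elim0 Fin.elim0).1 b =
        y ⟨0, hn⟩ l Fin.elim0 Fin.elim0 b / q l := by
  obtain ⟨σ, hσ, h₀⟩ := h.swap.exists_strategy hn hq
  refine ⟨fun t l hA hB => σ t l hB hA, fun s => ?_, h₀⟩
  rw [dualPayoff₁_eq_neg_dualPayoff₂]
  exact neg_le.1 (hσ _)

theorem exists_dualFeasible₂_of_strategy [Fintype K] [Fintype L] [Fintype A] [Fintype B]
    [Nonempty A] (hn : 0 < n) {M : K → L → A → B → ℝ}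
    {μ : K → ℝ} {q : L → ℝ} (hq : q ∈ stdSimplex ℝ L) {v : ℝ} {τ : Strategy₂ n L A B}
    (hτ : ∀ s, dualPayoff₁ M μ q s τ ≤ v) :
    ∃ y w w₀, DualFeasible₂ M μ q y w w₀ v ∧
      ∀ l, 0 < q l → ∀ b, (τ ⟨0, hn⟩ l Fin.elim0 Fin.elim0).1 b =
        y ⟨0, hn⟩ l Fin.elim0 Fin.elim0 b / q l := by
  obtain ⟨x, u, u₀, h, h₀⟩ := exists_dualFeasible₁_of_strategy (v := -v)
    (M := fun l k b a => -M k l a b) (ν := -μ) hn hq (σ := Strategy₂.swap τ) fun s => by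
      have := hτ (s.1, fun t k hA hB => s.2 t k hB hA)
      rw [dualPayoff₁_eq_neg_dualPayoff₂] at this
      exact neg_le.1 this
  exact ⟨_, _, _, h.swap, h₀⟩

end Swap

end BayesianGame

theorem mainTheorem3 {K L A B : Type*} [Fintype K] [Fintype L] [Fintype A] [Fintype B]
    [Nonempty K] [Nonempty L] [Nonempty A] [Nonempty B]
    (M : K → L → A → B → ℝ) (n : ℕ) (hn : 0 < n) :
    (∀ (p : K → ℝ), p ∈ stdSimplex ℝ K → ∀ (ν : L → ℝ), ∃ v : ℝ,
      BayesianGame.HasValue (BayesianGame.dualPayoff₂ (n := n) M p ν) v ∧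
      IsGreatest {uTop : ℝ | ∃ x u u₀,
        BayesianGame.DualFeasible₁ (n := n) M p ν x u u₀ uTop} v ∧
      (∀ x u u₀, BayesianGame.DualFeasible₁ (n := n) M p ν x u u₀ v →
        ∃ σ : BayesianGame.Strategy₁ n K A B,
          BayesianGame.IsSecurityStrategy₁ (BayesianGame.dualPayoff₂ M p ν) σ ∧
          ∀ k, 0 < p k → ∀ a, (σ ⟨0, hn⟩ k Fin.elim0 Fin.elim0).1 a =
            x ⟨0, hn⟩ k Fin.elim0 Fin.elim0 a / p k) ∧
      (∀ σ : BayesianGame.Strategy₁ n K A B,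
        BayesianGame.IsSecurityStrategy₁ (BayesianGame.dualPayoff₂ M p ν) σ →
        ∃ x u u₀, BayesianGame.DualFeasible₁ (n := n) M p ν x u u₀ v ∧
          ∀ k, 0 < p k → ∀ a, (σ ⟨0, hn⟩ k Fin.elim0 Fin.elim0).1 a =
            x ⟨0, hn⟩ k Fin.elim0 Fin.elim0 a / p k)) ∧
    (∀ (μ : K → ℝ) (q : L → ℝ), q ∈ stdSimplex ℝ L → ∃ v : ℝ,
      BayesianGame.HasValue (BayesianGame.dualPayoff₁ (n := n) M μ q) v ∧
      IsLeast {wTop : ℝ | ∃ y w w₀,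
        BayesianGame.DualFeasible₂ (n := n) M μ q y w w₀ wTop} v ∧
      (∀ y w w₀, BayesianGame.DualFeasible₂ (n := n) M μ q y w w₀ v →
        ∃ τ : BayesianGame.Strategy₂ n L A B,
          BayesianGame.IsSecurityStrategy₂ (BayesianGame.dualPayoff₁ M μ q) τ ∧
          ∀ l, 0 < q l → ∀ b, (τ ⟨0, hn⟩ l Fin.elim0 Fin.elim0).1 b =
            y ⟨0, hn⟩ l Fin.elim0 Fin.elim0 b / q l) ∧
      (∀ τ : BayesianGame.Strategy₂ n L A B,
        BayesianGame.IsSecurityStrategy₂ (BayesianGame.dualPayoff₁ M μ q) τ →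
        ∃ y w w₀, BayesianGame.DualFeasible₂ (n := n) M μ q y w w₀ v ∧
          ∀ l, 0 < q l → ∀ b, (τ ⟨0, hn⟩ l Fin.elim0 Fin.elim0).1 b =
            y ⟨0, hn⟩ l Fin.elim0 Fin.elim0 b / q l)) := by
  open BayesianGame in
  constructor
  · intro p hp ν
    obtain ⟨v, h₁, h₂⟩ := exists_saddle_dualPayoff₂ (n := n) M hp ν
    have hs := isSecurityStrategy₁_iff_of_saddle h₁ h₂
    refine ⟨v, ⟨isSecurityLevel₁_of_saddle h₁ h₂, isSecurityLevel₂_of_saddle h₁ h₂⟩,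
      ⟨?_, ?_⟩, ?_, ?_⟩
    · obtain ⟨σ, hσ⟩ := h₁
      obtain ⟨x, u, u₀, h, -⟩ := exists_dualFeasible₁_of_strategy hn hp hσ
      exact ⟨x, u, u₀, h⟩
    -- A feasible objective is a guaranteed payoff, and player 2's saddle strategy holds every
    -- strategy of player 1 to at most `v`.
    · rintro w ⟨x, u, u₀, h⟩
      obtain ⟨σ, hσ, -⟩ := h.exists_strategy hn hp
      obtain ⟨s, hs⟩ := h₂
      exact (hσ s).trans (hs σ)
    · intro x u u₀ h
      obtain ⟨σ, hσ, h₀⟩ := h.exists_strategy hn hp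
      exact ⟨σ, (hs σ).2 hσ, h₀⟩
    · exact fun σ hσ => exists_dualFeasible₁_of_strategy hn hp ((hs σ).1 hσ)
  · intro μ q hq
    obtain ⟨v, h₁, h₂⟩ := exists_saddle_dualPayoff₁ (n := n) M μ hq
    have hs := isSecurityStrategy₂_iff_of_saddle h₁ h₂
    refine ⟨v, ⟨isSecurityLevel₁_of_saddle h₁ h₂, isSecurityLevel₂_of_saddle h₁ h₂⟩,
      ⟨?_, ?_⟩, ?_, ?_⟩
    · obtain ⟨τ, hτ⟩ := h₂
      obtain ⟨y, w, w₀, h, -⟩ := exists_dualFeasible₂_of_strategy hn hq hτ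
      exact ⟨y, w, w₀, h⟩
    · rintro w ⟨y, w', w₀, h⟩
      obtain ⟨τ, hτ, -⟩ := h.exists_strategy hn hq
      obtain ⟨s, hs⟩ := h₁
      exact (hs τ).trans (hτ s)
    · intro y w w₀ h
      obtain ⟨τ, hτ, h₀⟩ := h.exists_strategy hn hq
      exact ⟨τ, (hs τ).2 hτ, h₀⟩
    · exact fun τ hτ => exists_dualFeasible₂_of_strategy hn hq ((hs τ).1 hτ)
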